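/- Say that a family of vectors $\{\phi_i\}_{i=1}^n$ in $\mathbb{R}^d$ does phase retrieval if, for all $x,y\in\mathbb{R}^d$, the equalities $|\langle x,\phi_i\rangle|=|\langle y,\phi_i\rangle|$ for $i=1,\dots,n$ imply $x=\pm y$. Say that a family of linear subspaces $\{W_i\}_{i=1}^n$ of $\mathbb{R}^d$, with orthogonal projections $P_i$ onto $W_i$, does phase retrieval if, for all $x,y\in\mathbb{R}^d$, the equalities $\|P_ix\|=\|P_iy\|$ for $i=1,\dots,n$ imply $x=\pm y$. Corollary. There are six distinct hyperplanes ($3$-dimensional linear subspaces) $W_1,\dots,W_6$ of $\mathbb{R}^4$ such that $\{W_i\}_{i=1}^6$ does phase retrieval, while the family of lines $\{W_i^\perp\}_{i=1}^6$ does not do phase retrieval; moreover, no family of normal vectors $\{\phi_i\}_{i=1}^6$ with $W_i^\perp=\operatorname{span}\{\phi_i\}$ for all $i$ does phase retrieval. -/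

import Mathlib

/-- A finite family of vectors `φ` in `ℝ^d` does phase retrieval if the intensity measurements
`|⟨x, φ i⟩|` determine `x` up to sign. -/
def VectorsDoPhaseRetrieval {d n : ℕ} (φ : Fin n → EuclideanSpace ℝ (Fin d)) : Prop :=
  ∀ x y : EuclideanSpace ℝ (Fin d),
    (∀ i, |inner ℝ x (φ i)| = |inner ℝ y (φ i)|) → x = y ∨ x = -y

/-- A finite family of subspaces `W` of `ℝ^d` does phase retrieval if the norms of the orthogonal
projections `P_i x` of `x` onto the `W i` determine `x` up to sign. -/
def SubspacesDoPhaseRetrieval {d n : ℕ}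
    (W : Fin n → Submodule ℝ (EuclideanSpace ℝ (Fin d))) : Prop :=
  ∀ x y : EuclideanSpace ℝ (Fin d),
    (∀ i, ‖(W i).starProjection x‖ = ‖(W i).starProjection y‖) → x = y ∨ x = -y

/-- A (linear) hyperplane of `ℝ^d`: a subspace of codimension one. -/
def IsLinearHyperplane {d : ℕ} (W : Submodule ℝ (EuclideanSpace ℝ (Fin d))) : Prop :=
  Module.finrank ℝ W + 1 = d

/-!
Let `φ` be a nonzero vector and `W = φᗮ`. Polarizing with `u = x - y` and `v = x + y`, the equality
`‖P_W x‖ = ‖P_W y‖` becomes the bilinear equation `‖φ‖² ⟪u, v⟫ = ⟪φ, u⟫ ⟪φ, v⟫`. So six hyperplanes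
with normals `φ i` do phase retrieval as soon as the six symmetric bilinear forms
`‖φ i‖² ⟪u, v⟫ - ⟪φ i, u⟫ ⟪φ i, v⟫` on `ℝ⁴` have no common zero `(u, v)` with `u ≠ 0` and `v ≠ 0`.

For the normals chosen below, the six equations express the off-diagonal entries of the symmetric
matrix `Q = u vᵀ + v uᵀ` as linear forms in `u i * v i`, so `Q` lies in an explicit
four-dimensional space of symmetric matrices (`systemSolution`). On the other hand, a skew-symmetric
matrix `Ω` satisfies `tr (Ω Q Ω Q) = 2 (uᵀ Ω v)² ≥ 0` for every `Q` of this shape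
(`trace_skew_mul_symmProduct`). For a suitable pair `Ω₁`, `Ω₂` the quadratic form
`tr (Ω₁ Q Ω₁ Q) + tr (Ω₂ Q Ω₂ Q)` is negative definite on the four-dimensional space
(`trace_skewCertificates_systemSolution`). Hence `Q = 0`, and then `u = 0` or `v = 0`.

The normals themselves fail phase retrieval because six vectors in `ℝ⁴` can be split into two triples,
neither of which spans: if `u` is orthogonal to the first triple and `v` to the second one, then
`u + v` and `u - v` have the same intensities. Rescaling the normals, or replacing them by the lines
they span, multiplies both intensities by the same factor
(`abs_inner_hyperplaneNormal_eq`).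
-/

/-! ### Hyperplanes and their normals -/

section InnerProductSpace

variable {E : Type*} [NormedAddCommGroup E] [InnerProductSpace ℝ E]

/-- Polarized form of the equality of norms of projections onto the hyperplane `φᗮ`. -/
theorem norm_sq_mul_inner_sub_add_eq_of_norm_starProjection_eq {φ x y : E}
    (h : ‖(ℝ ∙ φ)ᗮ.starProjection x‖ = ‖(ℝ ∙ φ)ᗮ.starProjection y‖) :
    ‖φ‖ ^ 2 * inner ℝ (x - y) (x + y) = inner ℝ φ (x - y) * inner ℝ φ (x + y) := by
  rcases eq_or_ne φ 0 with rfl | hφ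
  · simp
  have hφ' : ‖φ‖ ^ 2 ≠ 0 := by positivity
  have norm_sq_line (z : E) :
      ‖φ‖ ^ 2 * ‖(ℝ ∙ φ).starProjection z‖ ^ 2 = inner ℝ φ z ^ 2 := by
    rw [Submodule.starProjection_singleton, norm_smul, mul_pow, Real.norm_eq_abs, sq_abs]
    simp only [RCLike.ofReal_real_eq_id, id]
    field_simp
  have pythagoras (z : E) :
      ‖φ‖ ^ 2 * ‖(ℝ ∙ φ)ᗮ.starProjection z‖ ^ 2 = ‖φ‖ ^ 2 * ‖z‖ ^ 2 - inner ℝ φ z ^ 2 := by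
    rw [← norm_sq_line, Submodule.norm_sq_eq_add_norm_sq_starProjection z (ℝ ∙ φ)]
    ring
  have hxy := pythagoras x
  rw [h, pythagoras y] at hxy
  simp only [inner_sub_left, inner_sub_right, inner_add_right, real_inner_self_eq_norm_sq,
    real_inner_comm x y]
  linear_combination -hxy

/-- Vectors with the same intensity against `φ` have projections of the same norm onto the line
spanned by `φ`. -/
theorem norm_starProjection_span_singleton_eq {φ x y : E}
    (h : |inner ℝ x φ| = |inner ℝ y φ|) :
    ‖(ℝ ∙ φ).starProjection x‖ = ‖(ℝ ∙ φ).starProjection y‖ := by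
  rw [real_inner_comm, real_inner_comm φ y] at h
  simp [Submodule.starProjection_singleton, norm_smul, h]

end InnerProductSpace

/-- The normals of the six hyperplanes. -/
noncomputable def hyperplaneNormal : Fin 6 → EuclideanSpace ℝ (Fin 4) :=
  ![!₂[0, 0, 1, -1], !₂[0, 1, -1, -1], !₂[0, 1, -1, 1],
    !₂[1, -1, -1, 0], !₂[1, -1, 0, 1], !₂[1, 1, -1, -1]]

theorem hyperplaneNormal_ne_zero (i : Fin 6) : hyperplaneNormal i ≠ 0 := by
  intro h
  have h1 := congr($h 1)
  have h2 := congr($h 2)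
  fin_cases i <;> simp [hyperplaneNormal] at h1 h2

theorem hyperplaneNormal_mem_span_singleton {i j : Fin 6}
    (h : hyperplaneNormal i ∈ ℝ ∙ hyperplaneNormal j) : i = j := by
  obtain ⟨c, hc⟩ := Submodule.mem_span_singleton.1 h
  have h0 := congr($hc 0)
  have h1 := congr($hc 1)
  have h2 := congr($hc 2)
  have h3 := congr($hc 3)
  fin_cases i <;> fin_cases j <;> first
    | rfl
    | exfalso; simp [hyperplaneNormal] at h0 h1 h2 h3; try linarith

/-- The witnesses are `u + v` and `u - v`, where `u = (1, 0, 0, 0)` is orthogonal to the first three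
normals and `v = (-1, 1, -2, 2)` to the last three. -/
theorem abs_inner_hyperplaneNormal_eq (i : Fin 6) :
    |inner ℝ (!₂[0, 1, -2, 2] : EuclideanSpace ℝ (Fin 4)) (hyperplaneNormal i)| =
      |inner ℝ (!₂[2, -1, 2, -2] : EuclideanSpace ℝ (Fin 4)) (hyperplaneNormal i)| := by
  rw [abs_eq_abs]
  fin_cases i <;> simp [hyperplaneNormal, PiLp.inner_apply, Fin.sum_univ_four] <;> norm_num

theorem phaseWitness_ne :
    ¬ ((!₂[0, 1, -2, 2] : EuclideanSpace ℝ (Fin 4)) = !₂[2, -1, 2, -2] ∨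
      (!₂[0, 1, -2, 2] : EuclideanSpace ℝ (Fin 4)) = -!₂[2, -1, 2, -2]) := by
  rintro (h | h) <;> simpa using congr($h 0)

/-! ### Symmetric products and skew-symmetric forms -/

section SymmProduct

open Matrix

/-- A symmetric product `u vᵀ + v uᵀ` vanishes only if one of its factors does. -/
theorem eq_zero_or_eq_zero_of_symmProduct_eq_zero {ι : Type*} {u v : ι → ℝ}
    (h : vecMulVec u v + vecMulVec v u = 0) : u = 0 ∨ v = 0 := by
  have h' (i j : ι) : u i * v j + v i * u j = 0 := congr_fun₂ h i j
  by_contra! hne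
  obtain ⟨i, hi⟩ := Function.ne_iff.1 hne.1
  obtain ⟨j, hj⟩ := Function.ne_iff.1 hne.2
  have hvi : v i = 0 := (mul_eq_zero.1 (by linarith [h' i i] : u i * v i = 0)).resolve_left hi
  have := h' i j
  rw [hvi, zero_mul, add_zero] at this
  exact mul_ne_zero hi hj this

/-- For skew-symmetric `Ω`, the quadratic form `Q ↦ tr (Ω Q Ω Q)` is nonnegative on symmetric
products `Q = u vᵀ + v uᵀ`; on general symmetric matrices it also takes negative values, unless
`Ω = 0`. -/
theorem trace_skew_mul_symmProduct {ι : Type*} [Fintype ι] {Ω : Matrix ι ι ℝ} (hΩ : Ωᵀ = -Ω)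
    (u v : ι → ℝ) :
    (Ω * (vecMulVec u v + vecMulVec v u) * (Ω * (vecMulVec u v + vecMulVec v u))).trace =
      2 * (u ⬝ᵥ Ω *ᵥ v) ^ 2 := by
  have skew (x y : ι → ℝ) : y ⬝ᵥ Ω *ᵥ x = -(x ⬝ᵥ Ω *ᵥ y) := by
    rw [dotProduct_mulVec, ← mulVec_transpose, hΩ, neg_mulVec, neg_dotProduct, dotProduct_comm]
  have hu : u ⬝ᵥ Ω *ᵥ u = 0 := by linarith [skew u u]
  have hv : v ⬝ᵥ Ω *ᵥ v = 0 := by linarith [skew v v]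
  have hΩQ : Ω * (vecMulVec u v + vecMulVec v u) =
      vecMulVec (Ω *ᵥ u) v + vecMulVec (Ω *ᵥ v) u := by
    rw [mul_add, mul_vecMulVec, mul_vecMulVec]
  rw [hΩQ]
  simp only [mul_add, add_mul, vecMulVec_mul_vecMulVec, trace_add, trace_vecMulVec,
    smul_dotProduct, smul_eq_mul, dotProduct_comm (Ω *ᵥ _), skew u v, hu, hv]
  ring

/-- The unique symmetric matrix `Q` with diagonal `(2 * a, 2 * b, 2 * c, 2 * d)` satisfying
`‖φ‖² tr Q = φᵀ Q φ` for each of the six normals `φ`. -/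
def systemSolution (a b c d : ℝ) : Matrix (Fin 4) (Fin 4) ℝ :=
  !![2 * a, -5 * a - 3 * b - c - 3 * d, -b - 3 * c - 2 * d, -5 * a - 3 * b + c - 2 * d;
    -5 * a - 3 * b - c - 3 * d, 2 * b, -3 * a - 2 * b - 2 * c - 2 * d, -2 * a - 2 * b - c - d;
    -b - 3 * c - 2 * d, -3 * a - 2 * b - 2 * c - 2 * d, 2 * c, -2 * a - 2 * b - c - d;
    -5 * a - 3 * b + c - 2 * d, -2 * a - 2 * b - c - d, -2 * a - 2 * b - c - d, 2 * d]

/-- First of the two skew-symmetric matrices certifying nonsingularity. They are chosen so that the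
sum of the forms `tr (Ω Q Ω Q)` is negative definite on the matrices `systemSolution a b c d`. -/
def skewCertificateFst : Matrix (Fin 4) (Fin 4) ℝ :=
  !![0, -1, 3, 2; 1, 0, 1, -1; -3, -1, 0, -2; -2, 1, 2, 0]

/-- Second of the two skew-symmetric matrices certifying nonsingularity. -/
def skewCertificateSnd : Matrix (Fin 4) (Fin 4) ℝ :=
  !![0, 2, -2, -1; -2, 0, 3, -1; 2, -3, 0, 1; 1, 1, -1, 0]

theorem transpose_skewCertificateFst : skewCertificateFstᵀ = -skewCertificateFst := by
  ext i j
  fin_cases i <;> fin_cases j <;> simp [skewCertificateFst]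

theorem transpose_skewCertificateSnd : skewCertificateSndᵀ = -skewCertificateSnd := by
  ext i j
  fin_cases i <;> fin_cases j <;> simp [skewCertificateSnd]

/-- The right-hand side is a negative definite quadratic form in `(a, b, c, d)`: the first, third,
fourth and fifth linear forms have no common zero except the origin. -/
theorem trace_skewCertificates_systemSolution (a b c d : ℝ) :
    (skewCertificateFst * systemSolution a b c d *
        (skewCertificateFst * systemSolution a b c d)).trace +
      (skewCertificateSnd * systemSolution a b c d *
        (skewCertificateSnd * systemSolution a b c d)).trace =
      -2 * ((a + b + c + 2 * d) ^ 2 + (7 * a + 4 * b - c + 4 * d) ^ 2 + (2 * c - a - b) ^ 2 +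
        (2 * a + 3 * b) ^ 2 + a ^ 2) := by
  simp [skewCertificateFst, skewCertificateSnd, systemSolution, Matrix.trace, Fin.sum_univ_four]
  ring

theorem eq_zero_or_eq_zero_of_hyperplaneNormal_equations {u v : EuclideanSpace ℝ (Fin 4)}
    (h : ∀ i, ‖hyperplaneNormal i‖ ^ 2 * inner ℝ u v =
      inner ℝ (hyperplaneNormal i) u * inner ℝ (hyperplaneNormal i) v) : u = 0 ∨ v = 0 := by
  have e0 := h 0
  have e1 := h 1
  have e2 := h 2
  have e3 := h 3
  have e4 := h 4
  have e5 := h 5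
  simp only [hyperplaneNormal, EuclideanSpace.norm_sq_eq, PiLp.inner_apply, Fin.sum_univ_four]
    at e0 e1 e2 e3 e4 e5
  simp at e0 e1 e2 e3 e4 e5
  -- The six equations determine the off-diagonal entries of `u vᵀ + v uᵀ` from the diagonal ones.
  obtain ⟨a, ha⟩ : ∃ a, a = u 0 * v 0 := ⟨_, rfl⟩
  obtain ⟨b, hb⟩ : ∃ b, b = u 1 * v 1 := ⟨_, rfl⟩
  obtain ⟨c, hc⟩ : ∃ c, c = u 2 * v 2 := ⟨_, rfl⟩
  obtain ⟨d, hd⟩ : ∃ d, d = u 3 * v 3 := ⟨_, rfl⟩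
  have hQ : vecMulVec u v + vecMulVec v u = systemSolution a b c d := by
    ext i j
    fin_cases i <;> fin_cases j <;> simp [vecMulVec_apply, systemSolution] <;> linarith
  have hsos := trace_skewCertificates_systemSolution a b c d
  rw [← hQ, trace_skew_mul_symmProduct transpose_skewCertificateFst,
    trace_skew_mul_symmProduct transpose_skewCertificateSnd] at hsos
  have hle : (a + b + c + 2 * d) ^ 2 + (7 * a + 4 * b - c + 4 * d) ^ 2 + (2 * c - a - b) ^ 2 +
      (2 * a + 3 * b) ^ 2 + a ^ 2 ≤ 0 := by
    linarith only [hsos, sq_nonneg (u ⬝ᵥ skewCertificateFst *ᵥ v),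
      sq_nonneg (u ⬝ᵥ skewCertificateSnd *ᵥ v)]
  have hsq : (a + b + c + 2 * d) ^ 2 = 0 ∧ (2 * c - a - b) ^ 2 = 0 ∧ (2 * a + 3 * b) ^ 2 = 0 ∧
      a ^ 2 = 0 := by
    refine ⟨?_, ?_, ?_, ?_⟩ <;> refine le_antisymm ?_ (sq_nonneg _) <;>
      refine le_trans ?_ hle <;>
      linarith only [sq_nonneg (a + b + c + 2 * d), sq_nonneg (7 * a + 4 * b - c + 4 * d),
        sq_nonneg (2 * c - a - b), sq_nonneg (2 * a + 3 * b), sq_nonneg a]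
  simp only [sq_eq_zero_iff] at hsq
  obtain ⟨hd0, hc0, hb0, ha0⟩ := hsq
  obtain rfl : a = 0 := ha0
  obtain rfl : b = 0 := by linarith only [hb0]
  obtain rfl : c = 0 := by linarith only [hc0]
  obtain rfl : d = 0 := by linarith only [hd0]
  have hQ0 : vecMulVec u v + vecMulVec v u = 0 := by
    rw [hQ]
    ext i j
    fin_cases i <;> fin_cases j <;> simp [systemSolution]
  exact (eq_zero_or_eq_zero_of_symmProduct_eq_zero hQ0).imp
    (WithLp.ofLp_injective 2 ·) (WithLp.ofLp_injective 2 ·)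

end SymmProduct

/-! ### Phase retrieval by hyperplanes but not by their normals -/

theorem mainTheorem9 :
    ∃ W : Fin 6 → Submodule ℝ (EuclideanSpace ℝ (Fin 4)),
      Function.Injective W ∧
      (∀ i, IsLinearHyperplane (W i)) ∧
      SubspacesDoPhaseRetrieval W ∧
      ¬ SubspacesDoPhaseRetrieval (fun i => (W i)ᗮ) ∧
      ∀ φ : Fin 6 → EuclideanSpace ℝ (Fin 4),
        (∀ i, (W i)ᗮ = Submodule.span ℝ {φ i}) → ¬ VectorsDoPhaseRetrieval φ := by
  refine ⟨fun i => (ℝ ∙ hyperplaneNormal i)ᗮ, ?_, ?_, ?_, ?_, ?_⟩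
  · intro i j hij
    have hspan := congrArg Submodule.orthogonal hij
    simp only [Submodule.orthogonal_orthogonal] at hspan
    exact hyperplaneNormal_mem_span_singleton
      (hspan.le (Submodule.mem_span_singleton_self _))
  · intro i
    have := Submodule.finrank_add_finrank_orthogonal (ℝ ∙ hyperplaneNormal i)
    rw [finrank_span_singleton (hyperplaneNormal_ne_zero i), finrank_euclideanSpace_fin] at this
    rw [IsLinearHyperplane, add_comm, this]
  · intro x y hxy
    rcases eq_zero_or_eq_zero_of_hyperplaneNormal_equations fun i =>
      norm_sq_mul_inner_sub_add_eq_of_norm_starProjection_eq (hxy i) with h | h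
    · exact .inl (sub_eq_zero.1 h)
    · exact .inr (eq_neg_of_add_eq_zero_left h)
  · intro hW
    refine phaseWitness_ne (hW _ _ fun i => ?_)
    simp only [Submodule.orthogonal_orthogonal]
    exact norm_starProjection_span_singleton_eq (abs_inner_hyperplaneNormal_eq i)
  · intro φ hφ hret
    refine phaseWitness_ne (hret _ _ fun i => ?_)
    have hmem : φ i ∈ ℝ ∙ hyperplaneNormal i := by
      rw [← (ℝ ∙ hyperplaneNormal i).orthogonal_orthogonal, hφ i]
      exact Submodule.mem_span_singleton_self _
    obtain ⟨c, hc⟩ := Submodule.mem_span_singleton.1 hmem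
    rw [← hc, real_inner_smul_right, real_inner_smul_right, abs_mul, abs_mul,
      abs_inner_hyperplaneNormal_eq]
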